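/- Let $\mathbb{K}$ be an algebraically closed field of characteristic $0$. For a variable $y$ of a polynomial ring $R$ in finitely many variables over $\mathbb{K}$ and $0\ne f\in R$, write $f=\sum_{i=0}^{d}\alpha_i y^i$ with the $\alpha_i$ free of $y$ and $\alpha_d\neq 0$, and put $\mathrm{in}_y(f)=\alpha_d y^d$; for an ideal $I\subseteq R$ let $\mathrm{in}_y(I)$ be the ideal generated by all $\mathrm{in}_y(f)$, $0\neq f\in I$. A monomial order $<$ on $R$ is $y$-compatible if the initial terms satisfy $\mathrm{in}_<(f)=\mathrm{in}_<(\mathrm{in}_y(f))$ for all $f$. Given a $y$-compatible order and a Gröbner basis $g_1,\dots,g_m$ of $I$ with respect to it, write $\mathrm{in}_y(g_i)=y^{d_i}q_i$ with $q_i$ free of $y$, and put $C_{y,I}=\langle q_1,\dots,q_m\rangle$ and $N_{y,I}=\langle q_i \mid d_i=0\rangle$ (these ideals do not depend on the choices). An ideal $I$ is unmixed if $\dim(R/I)=\dim(R/P)$ for all associated primes $P$ of $R/I$. Recursively on the number of variables, an ideal $I$ of $R$ is called geometrically vertex decomposable if $I$ is unmixed and either (1) $I=\langle 1\rangle$ or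 $I$ is generated by a (possibly empty) subset of the variables of $R$; or (2) there are a variable $y$ of $R$ and a $y$-compatible monomial order such that $\mathrm{in}_y(I)=C_{y,I}\cap(N_{y,I}+\langle y\rangle)$ and the contractions of $C_{y,I}$ and $N_{y,I}$ to the polynomial ring over $\mathbb{K}$ in the variables of $R$ other than $y$ are geometrically vertex decomposable. In particular, the ideals $\langle 0\rangle$ and $\langle 1\rangle$ of $\mathbb{K}$ (no variables) are geometrically vertex decomposable. **Theorem.** Let $I\subsetneq \mathbb{K}[x_1,\dots,x_n]$ and $J\subsetneq \mathbb{K}[y_1,\dots,y_m]$ be proper ideals in polynomial rings on disjoint sets of variables. Then $I$ and $J$ are both geometrically vertex decomposable if and only if the ideal $I+J$ generated by $I$ and $J$ is geometrically vertex decomposable in $\mathbb{K}[x_1,\dots,x_n,y_1,\dots,y_m]$. -/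

import Mathlib

universe u v

namespace GVD

open MvPolynomial

variable {σ : Type u} {K : Type v} [Field K]

/-- Writing `f = ∑ i, α_i * y ^ i` with the `α_i` not involving the variable `y`, this is `α_i`
(regarded as an element of the full polynomial ring). -/
noncomputable def yCoeff (y : σ) (i : ℕ) (f : MvPolynomial σ K) : MvPolynomial σ K :=
  ∑ d ∈ f.support with d y = i, monomial (d.erase y) (coeff d f)

/-- The coefficient `α_d` of the highest power `y ^ d` of `y` appearing in `f`
(it is `0` for `f = 0`). -/
noncomputable def yLeadCoeff (y : σ) (f : MvPolynomial σ K) : MvPolynomial σ K :=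
  yCoeff y (f.degreeOf y) f

/-- The initial `y`-form `in_y(f) = α_d * y ^ d` of `f` (it is `0` for `f = 0`). -/
noncomputable def initialYForm (y : σ) (f : MvPolynomial σ K) : MvPolynomial σ K :=
  yLeadCoeff y f * X y ^ f.degreeOf y

/-- The ideal `in_y(I)` generated by the initial `y`-forms of the elements of `I`. -/
noncomputable def initialYIdeal (y : σ) (I : Ideal (MvPolynomial σ K)) :
    Ideal (MvPolynomial σ K) :=
  Ideal.span (initialYForm y '' (I : Set (MvPolynomial σ K)))

/-- The initial ideal of `I` with respect to the monomial order `m`. -/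
noncomputable def initialIdeal (m : MonomialOrder σ) (I : Ideal (MvPolynomial σ K)) :
    Ideal (MvPolynomial σ K) :=
  Ideal.span (m.leadingTerm '' (I : Set (MvPolynomial σ K)))

/-- The finite set `G` is a Gröbner basis of `I` with respect to the monomial order `m`. -/
def IsGroebnerBasis (m : MonomialOrder σ) (G : Finset (MvPolynomial σ K))
    (I : Ideal (MvPolynomial σ K)) : Prop :=
  (∀ g ∈ G, g ∈ I) ∧
    initialIdeal m I = Ideal.span (m.leadingTerm '' (G : Set (MvPolynomial σ K)))

variable (K) in
/-- The monomial order `m` is `y`-compatible: `in_<(f) = in_<(in_y(f))` for all `f`. -/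
def IsYCompatible (m : MonomialOrder σ) (y : σ) : Prop :=
  ∀ f : MvPolynomial σ K, m.leadingTerm f = m.leadingTerm (initialYForm y f)

/-- The ideal `C_y` attached to a Gröbner basis `G`: it is generated by the `q_g`, where
`in_y(g) = y ^ d_g * q_g` for `g` in `G`. -/
noncomputable def idealC (y : σ) (G : Finset (MvPolynomial σ K)) : Ideal (MvPolynomial σ K) :=
  Ideal.span {q | ∃ g ∈ G, q = yLeadCoeff y g}

/-- The ideal `N_y` attached to a Gröbner basis `G`: it is generated by the `q_g` for those `g`
in `G` with `d_g = 0`, where `in_y(g) = y ^ d_g * q_g`. -/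
noncomputable def idealN (y : σ) (G : Finset (MvPolynomial σ K)) : Ideal (MvPolynomial σ K) :=
  Ideal.span {q | ∃ g ∈ G, g.degreeOf y = 0 ∧ q = yLeadCoeff y g}

/-- The contraction of an ideal to the polynomial ring in all variables except `y`. -/
noncomputable def contract (y : σ) (I : Ideal (MvPolynomial σ K)) :
    Ideal (MvPolynomial {x : σ // x ≠ y} K) :=
  I.comap (rename (Subtype.val : {x : σ // x ≠ y} → σ))

/-- The ideal `I` is unmixed: `dim (R / I) = dim (R / P)` for all associated primes `P` of
`R / I`. -/
def IsUnmixed {R : Type*} [CommRing R] (I : Ideal R) : Prop :=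
  ∀ P ∈ associatedPrimes R (R ⧸ I), ringKrullDim (R ⧸ I) = ringKrullDim (R ⧸ P)

/-- Geometrically vertex decomposable ideals of a polynomial ring in finitely many variables,
by recursion on the number of variables. In a polynomial ring in no variables,
the constructor `trivial` covers both ideals `0` and `1`. -/
inductive IsGeomVertexDecomposable {K : Type v} [Field K] :
    ∀ {σ : Type u}, Ideal (MvPolynomial σ K) → Prop
  | trivial {σ : Type u} (I : Ideal (MvPolynomial σ K)) (unmixed : IsUnmixed I)
      (h : I = ⊤ ∨ ∃ s : Set σ, I = Ideal.span (X '' s)) :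
      IsGeomVertexDecomposable I
  | step {σ : Type u} (I : Ideal (MvPolynomial σ K)) (unmixed : IsUnmixed I)
      (y : σ) (m : MonomialOrder.{u, u} σ) (compatible : IsYCompatible K m y)
      (G : Finset (MvPolynomial σ K)) (groebner : IsGroebnerBasis m G I)
      (decomposition : initialYIdeal y I = idealC y G ⊓ (idealN y G ⊔ Ideal.span {X y}))
      (hC : IsGeomVertexDecomposable (contract y (idealC y G)))
      (hN : IsGeomVertexDecomposable (contract y (idealN y G))) :
      IsGeomVertexDecomposable I

end GVD

/-! Write R/I and S/J for the two quotients; the quotient by I + J is their tensor product over K.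
Two facts carry the proof. Unmixedness: over a Noether normalization T, an ideal is unmixed exactly
when its quotient is a torsion-free T-module (`isUnmixed_iff_of_isIntegral_of_injective`). A tensor
product of nonzero finite algebras is torsion-free over the tensor product of the normalizations iff
both factors are torsion-free (`tensor_torsionFree_iff`), because finite torsion-free modules over a
domain have enough linear functionals. Decomposition: f lies in I + J iff every linear functional on
S killing J, applied to the second block of variables, sends f into I (`mem_join_iff`). Such a
contraction commutes with taking coefficients of powers of a variable y of the first block and does
not raise the y-degree. Hence in_y, C and N of I + J are those of I, plus J. Since C and N have
descriptions free of Gröbner bases (`idealC_eq`, `idealN_eq`), the recursive clause for I + J at y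
is the clause for I at y with J added throughout, and induction on the number of variables finishes.
-/

namespace GVD

open MvPolynomial TensorProduct

/-! ### Krull dimension under integral extensions, and unmixedness as torsion-freeness. -/

section KrullDim

/-- Lying over and going up lift chains of primes from A to B; incomparability makes contraction
strictly monotone, so chains in B descend with the same length. -/
theorem ringKrullDim_eq_of_isIntegral_of_injective {A B : Type*} [CommRing A] [CommRing B]
    (f : A →+* B) (hf : f.IsIntegral) (hinj : Function.Injective f) :
    ringKrullDim A = ringKrullDim B := by
  algebraize [f]
  apply le_antisymm
  · refine iSup_le fun l ↦ ?_
    obtain ⟨⟨P, hP⟩, hPl⟩ := hf.comap_surjective hinj l.head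
    have : P.LiesOver l.head.asIdeal := ⟨by rw [← hPl]; rfl⟩
    obtain ⟨L, hL, -⟩ := Ideal.exists_ltSeries_of_hasGoingUp (S := B) l P
    rw [← hL]
    exact le_iSup (fun p : LTSeries (PrimeSpectrum B) ↦ (p.length : WithBot ℕ∞)) L
  · refine Order.krullDim_le_of_strictMono (PrimeSpectrum.comap f) fun P Q hPQ ↦ ?_
    obtain ⟨x, hxQ, hxP⟩ := SetLike.exists_of_lt (show P.asIdeal < Q.asIdeal from hPQ)
    exact Ideal.comap_lt_comap_of_integral_mem_sdiff (R := A) hPQ.le ⟨hxQ, hxP⟩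
      (Algebra.IsIntegral.isIntegral x)

/-- Unmixedness read off from a Noether normalization. -/
theorem isUnmixed_iff_of_isIntegral_of_injective {R T : Type*} [CommRing R] [IsNoetherianRing R]
    [CommRing T] [IsDomain T] [FiniteRingKrullDim T] (I : Ideal R) (g : T →+* R ⧸ I)
    (hg : g.IsIntegral) (hinj : Function.Injective g) :
    IsUnmixed I ↔ ∀ t b, g t * b = 0 → t = 0 ∨ b = 0 := by
  have hdim := ringKrullDim_eq_of_isIntegral_of_injective g hg hinj
  have smul_eq (r : R) (b : R ⧸ I) : r • b = Ideal.Quotient.mk I r * b := rfl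
  constructor
  · intro h t b htb
    -- A torsion element b lies behind an associated prime P containing its annihilator. Then t dies
    -- in R/P, so R/P is integral over a proper quotient of the domain T and has smaller dimension
    -- than R/I.
    by_contra! hne
    obtain ⟨P, hP, hPb⟩ := exists_le_isAssociatedPrime_of_isNoetherianRing R b hne.2
    have hIP : I ≤ P := fun r hr ↦ hPb <| by
      rw [Submodule.mem_colon_singleton, smul_eq, Ideal.Quotient.eq_zero_iff_mem.2 hr, zero_mul]
      exact zero_mem _
    set φ : T →+* R ⧸ P := (Ideal.Quotient.factor hIP).comp g
    have hφ : φ.IsIntegral :=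
      hg.trans _ _ (RingHom.isIntegral_of_surjective _ (Ideal.Quotient.factor_surjective hIP))
    have hφt : φ t = 0 := by
      obtain ⟨r, hr⟩ := Ideal.Quotient.mk_surjective (g t)
      rw [RingHom.comp_apply, ← hr, Ideal.Quotient.factor_mk, Ideal.Quotient.eq_zero_iff_mem]
      refine hPb ?_
      rw [Submodule.mem_colon_singleton, smul_eq, hr, htb]
      exact zero_mem _
    have h1 : ringKrullDim φ.range = ringKrullDim (R ⧸ P) :=
      ringKrullDim_eq_of_isIntegral_of_injective φ.range.subtype
        (fun x ↦ by
          obtain ⟨p, hp, hpx⟩ := hφ x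
          refine ⟨p.map φ.rangeRestrict, hp.map _, ?_⟩
          rw [Polynomial.eval₂_map]
          exact hpx) Subtype.val_injective
    have h2 := ringKrullDim_succ_le_of_surjective φ.rangeRestrict φ.rangeRestrict_surjective
      (mem_nonZeroDivisors_of_ne_zero hne.1) (Subtype.ext hφt)
    rw [h1, ← h P hP, ← hdim] at h2
    -- Finiteness of the dimension is what makes `dim T + 1 ≤ dim T` absurd.
    obtain ⟨n, hn⟩ : ∃ n : ℕ, ringKrullDim T = n := by
      have := ringKrullDim_ne_bot (R := T)
      have := ringKrullDim_ne_top (R := T)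
      cases hd : ringKrullDim T with
      | bot => contradiction
      | coe d => cases d with
        | top => simp_all
        | coe n => exact ⟨n, rfl⟩
    rw [hn] at h2
    norm_cast at h2
    omega
  · intro h P hP
    obtain ⟨hPp, b, rfl⟩ := isAssociatedPrime_iff.1 hP
    have hb : b ≠ 0 := by
      rintro rfl
      exact hPp.ne_top (by simp)
    have hIP : I ≤ (⊥ : Submodule R (R ⧸ I)).colon {b} := fun r hr ↦ by
      rw [Submodule.mem_colon_singleton, smul_eq, Ideal.Quotient.eq_zero_iff_mem.2 hr, zero_mul]
      exact zero_mem _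
    rw [← hdim]
    -- Here P is the annihilator of b, so torsion-freeness says that T still embeds in R/P.
    refine ringKrullDim_eq_of_isIntegral_of_injective ((Ideal.Quotient.factor hIP).comp g)
      (hg.trans _ _ (RingHom.isIntegral_of_surjective _ (Ideal.Quotient.factor_surjective hIP)))
      ((injective_iff_map_eq_zero _).2 fun t ht ↦ ?_)
    obtain ⟨r, hr⟩ := Ideal.Quotient.mk_surjective (g t)
    rw [RingHom.comp_apply, ← hr, Ideal.Quotient.factor_mk, Ideal.Quotient.eq_zero_iff_mem,
      Submodule.mem_colon_singleton, smul_eq, hr] at ht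
    exact (h t b ht).resolve_right hb

end KrullDim

/-! ### Torsion-free algebras and their tensor products. -/

section Tensor

variable {K M N : Type*} [Field K] [AddCommGroup M] [Module K M] [AddCommGroup N] [Module K N]

/-- A basis of M turns M ⊗ N into finitely supported families in N, on which `lTensor` acts
coordinatewise. -/
theorem eq_zero_of_forall_lTensor_eq_zero {ι : Type*} {N' : ι → Type*} [∀ i, AddCommGroup (N' i)]
    [∀ i, Module K (N' i)] (β : ∀ i, N →ₗ[K] N' i) (hβ : ∀ n, (∀ i, β i n = 0) → n = 0)
    (x : M ⊗[K] N) (hx : ∀ i, (β i).lTensor M x = 0) : x = 0 := by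
  classical
  let b := Module.Basis.ofVectorSpace K M
  have key (i) (y : M ⊗[K] N) (k) : TensorProduct.equivFinsuppOfBasisLeft b ((β i).lTensor M y) k =
      β i (TensorProduct.equivFinsuppOfBasisLeft b y k) := by
    induction y with
    | zero => simp
    | tmul m n => simp
    | add y z hy hz => simp [hy, hz]
  rw [← (TensorProduct.equivFinsuppOfBasisLeft b).map_eq_zero_iff]
  ext k
  exact hβ _ fun i ↦ by rw [← key, hx, map_zero, Finsupp.zero_apply]

theorem eq_zero_of_forall_rTensor_eq_zero {ι : Type*} {M' : ι → Type*} [∀ i, AddCommGroup (M' i)]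
    [∀ i, Module K (M' i)] (α : ∀ i, M →ₗ[K] M' i) (hα : ∀ n, (∀ i, α i n = 0) → n = 0)
    (x : M ⊗[K] N) (hx : ∀ i, (α i).rTensor N x = 0) : x = 0 := by
  rw [← (TensorProduct.comm K M N).map_eq_zero_iff]
  refine eq_zero_of_forall_lTensor_eq_zero α hα _ fun i ↦ ?_
  rw [LinearMap.lTensor_comm, hx, map_zero]

/-- A finitely generated torsion-free module over a domain is torsionless. -/
theorem exists_linearMap_apply_ne_zero {T M : Type*} [CommRing T] [IsDomain T] [AddCommGroup M]
    [Module T M] [Module.Finite T M] (h : ∀ (t : T) (x : M), t • x = 0 → t = 0 ∨ x = 0)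
    {x : M} (hx : x ≠ 0) : ∃ f : M →ₗ[T] T, f x ≠ 0 := by
  classical
  obtain ⟨n, s, hs⟩ := Module.Finite.exists_fin (R := T) (M := M)
  -- By maximality every generator has a nonzero multiple in the free span of the independent ones.
  -- The product of these multipliers maps all of M into that free module, injectively by
  -- torsion-freeness, and coordinates then give the functional.
  obtain ⟨I, indep, hI⟩ := exists_maximal_linearIndepOn T s
  have exists_a (i) : ∃ a : T, a ≠ 0 ∧ a • s i ∈ Submodule.span T (s '' I) := by
    by_cases hi : i ∈ I
    · exact ⟨1, one_ne_zero, by simpa using Submodule.subset_span (Set.mem_image_of_mem s hi)⟩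
    · exact hI i hi
  choose a ha ha' using exists_a
  have hmem (y : M) : (∏ i, a i) • y ∈ Submodule.span T (Set.range fun i : I ↦ s i) := by
    have hy : y ∈ Submodule.span T (Set.range s) := hs ▸ Submodule.mem_top
    rw [← Set.image_eq_range]
    induction hy using Submodule.span_induction with
    | mem y hy =>
      obtain ⟨i, rfl⟩ := hy
      rw [Fintype.prod_eq_prod_compl_mul i, mul_smul]
      exact Submodule.smul_mem _ _ (ha' i)
    | zero => simp
    | add y z _ _ hy hz => rw [smul_add]; exact add_mem hy hz
    | smul t y _ hy => rw [smul_comm]; exact Submodule.smul_mem _ _ hy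
  let b := Module.Basis.span indep
  let φ : M →ₗ[T] Submodule.span T (Set.range fun i : I ↦ s i) :=
    (LinearMap.lsmul T M (∏ i, a i)).codRestrict _ hmem
  by_contra! hf
  have : φ x = 0 := b.ext_elem fun i ↦ by simpa using hf (b.coord i ∘ₗ φ)
  have : (∏ i, a i) • x = 0 := congrArg Subtype.val this
  rcases h _ _ this with h | h
  · exact Finset.prod_ne_zero_iff.2 (fun i _ ↦ ha i) h
  · exact hx h

/-- One direction tests pure tensors with one factor 1. For the other, the maps α ⊗ β with α, β
functionals to S and T are linear over the domain S ⊗ T, so they kill torsion; jointly they separate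
the elements of A ⊗ B. -/
theorem tensor_torsionFree_iff {A B S T : Type*} [CommRing A] [CommRing B] [CommRing S]
    [CommRing T] [Algebra K A] [Algebra K B] [Algebra K S] [Algebra K T] [IsDomain S] [IsDomain T]
    [IsDomain (S ⊗[K] T)] [Nontrivial A] [Nontrivial B]
    (g : S →ₐ[K] A) (h : T →ₐ[K] B) (hg : g.Finite) (hh : h.Finite) :
    (∀ t b, Algebra.TensorProduct.map g h t * b = 0 → t = 0 ∨ b = 0) ↔
      (∀ t b, g t * b = 0 → t = 0 ∨ b = 0) ∧ (∀ t b, h t * b = 0 → t = 0 ∨ b = 0) := by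
  constructor
  · intro H
    constructor
    · intro t a hta
      have inj : Function.Injective (Algebra.TensorProduct.includeLeft : A →ₐ[K] A ⊗[K] B) :=
        Algebra.TensorProduct.includeLeft_injective (algebraMap K B).injective
      have inj' : Function.Injective (Algebra.TensorProduct.includeLeft : S →ₐ[K] S ⊗[K] T) :=
        Algebra.TensorProduct.includeLeft_injective (algebraMap K T).injective
      refine (H (t ⊗ₜ 1) (a ⊗ₜ 1) (by simp [hta])).imp (fun h0 ↦ inj' ?_) (fun h0 ↦ inj ?_)
      · simpa using h0
      · simpa using h0
    · intro t a hta
      have inj : Function.Injective (Algebra.TensorProduct.includeRight : B →ₐ[K] A ⊗[K] B) :=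
        Algebra.TensorProduct.includeRight_injective (algebraMap K A).injective
      have inj' : Function.Injective (Algebra.TensorProduct.includeRight : T →ₐ[K] S ⊗[K] T) :=
        Algebra.TensorProduct.includeRight_injective (algebraMap K S).injective
      refine (H (1 ⊗ₜ t) (1 ⊗ₜ a) (by simp [hta])).imp (fun h0 ↦ inj' ?_) (fun h0 ↦ inj ?_)
      · simpa using h0
      · simpa using h0
  · rintro ⟨HA, HB⟩ t x htx
    let _ := g.toRingHom.toAlgebra
    let _ := h.toRingHom.toAlgebra
    have : IsScalarTower K S A := .of_algebraMap_eq' g.comp_algebraMap.symm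
    have : IsScalarTower K T B := .of_algebraMap_eq' h.comp_algebraMap.symm
    have : Module.Finite S A := hg
    have : Module.Finite T B := hh
    have key (α : A →ₗ[S] S) (β : B →ₗ[T] T) (t : S ⊗[K] T) (x : A ⊗[K] B) :
        TensorProduct.map (α.restrictScalars K) (β.restrictScalars K)
          (Algebra.TensorProduct.map g h t * x) =
        t * TensorProduct.map (α.restrictScalars K) (β.restrictScalars K) x := by
      induction t with
      | zero => simp
      | add t t' ht ht' => simp [add_mul, ht, ht']
      | tmul s t =>
        induction x with
        | zero => simp
        | add y z hy hz => simp only [mul_add, map_add, hy, hz]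
        | tmul a b =>
          have h1 : α (g s * a) = s * α a := α.map_smul s a
          have h2 : β (h t * b) = t * β b := β.map_smul t b
          simp [h1, h2]
    refine or_iff_not_imp_left.2 fun ht ↦ ?_
    have hsep (α : A →ₗ[S] S) (β : B →ₗ[T] T) :
        TensorProduct.map (α.restrictScalars K) (β.restrictScalars K) x = 0 := by
      have := key α β t x
      rw [htx, map_zero, eq_comm, mul_eq_zero] at this
      exact this.resolve_left ht
    refine eq_zero_of_forall_lTensor_eq_zero (fun β : B →ₗ[T] T ↦ β.restrictScalars K) ?_ x
      fun β ↦ eq_zero_of_forall_rTensor_eq_zero (fun α : A →ₗ[S] S ↦ α.restrictScalars K) ?_ _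
        fun α ↦ ?_
    · intro b hb
      by_contra hne
      obtain ⟨f, hf⟩ := exists_linearMap_apply_ne_zero (T := T)
        (fun t b hb ↦ HB t b (by rwa [Algebra.smul_def] at hb)) hne
      exact hf (hb f)
    · intro b hb
      by_contra hne
      obtain ⟨f, hf⟩ := exists_linearMap_apply_ne_zero (T := S)
        (fun t b hb ↦ HA t b (by rwa [Algebra.smul_def] at hb)) hne
      exact hf (hb f)
    · rw [← LinearMap.comp_apply, LinearMap.rTensor_comp_lTensor]
      exact hsep α β

end Tensor

/-! ### Ideals in disjoint blocks of variables, and their sum as a tensor product. -/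

section Join

variable {K : Type v} [Field K] {σ τ ρ : Type u} (e : σ ⊕ τ ≃ ρ)

/-- Embedding of the polynomial ring in the first block of variables. -/
noncomputable abbrev inclLeft : MvPolynomial σ K →ₐ[K] MvPolynomial ρ K := rename (e ∘ Sum.inl)

/-- Embedding of the polynomial ring in the second block of variables. -/
noncomputable abbrev inclRight : MvPolynomial τ K →ₐ[K] MvPolynomial ρ K := rename (e ∘ Sum.inr)

/-- The ideal generated by two ideals in disjoint blocks of variables. -/
noncomputable def join (I : Ideal (MvPolynomial σ K)) (J : Ideal (MvPolynomial τ K)) :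
    Ideal (MvPolynomial ρ K) :=
  I.map (inclLeft e) ⊔ J.map (inclRight e)

/-- The equivalence `e` with an arbitrary ρ allows both blocks to be exchanged inside the same ring,
so that only variables of the first block need treatment. -/
theorem join_swap (I : Ideal (MvPolynomial σ K)) (J : Ideal (MvPolynomial τ K)) :
    join ((Equiv.sumComm τ σ).trans e) J I = join e I J := by
  rw [join, join, sup_comm]
  rfl

variable (K) in
/-- The polynomial ring in two blocks of variables is a tensor product. -/
noncomputable def tensorEquiv :
    MvPolynomial σ K ⊗[K] MvPolynomial τ K ≃ₐ[K] MvPolynomial ρ K :=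
  (tensorEquivSum K σ τ K).trans (renameEquiv K e)

theorem tensorEquiv_tmul (f : MvPolynomial σ K) (g : MvPolynomial τ K) :
    tensorEquiv K e (f ⊗ₜ g) = inclLeft e f * inclRight e g := by
  have h1 : (tensorEquiv K e).toAlgHom.comp Algebra.TensorProduct.includeLeft =
      inclLeft (K := K) e := by
    ext i
    simp [tensorEquiv]
  have h2 : ((tensorEquiv K e).toAlgHom.restrictScalars K).comp
      Algebra.TensorProduct.includeRight = inclRight (K := K) e := by
    ext i
    simp [tensorEquiv]
  rw [← h1, ← h2, ← mul_one f, ← one_mul g, ← Algebra.TensorProduct.tmul_mul_tmul, map_mul]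
  simp

theorem tensorEquiv_symm_mul (f : MvPolynomial σ K) (g : MvPolynomial τ K) :
    (tensorEquiv K e).symm (inclLeft e f * inclRight e g) = f ⊗ₜ g := by
  rw [← tensorEquiv_tmul, AlgEquiv.symm_apply_apply]

/-- The natural surjection whose kernel is `join e I J`. -/
noncomputable def joinQuot (I : Ideal (MvPolynomial σ K)) (J : Ideal (MvPolynomial τ K)) :
    MvPolynomial ρ K →ₐ[K] (MvPolynomial σ K ⧸ I) ⊗[K] (MvPolynomial τ K ⧸ J) :=
  (Algebra.TensorProduct.map (Ideal.Quotient.mkₐ K I) (Ideal.Quotient.mkₐ K J)).comp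
    (tensorEquiv K e).symm.toAlgHom

theorem joinQuot_surjective (I : Ideal (MvPolynomial σ K)) (J : Ideal (MvPolynomial τ K)) :
    Function.Surjective (joinQuot e I J) :=
  (TensorProduct.map_surjective (Ideal.Quotient.mkₐ_surjective K I)
    (Ideal.Quotient.mkₐ_surjective K J)).comp (tensorEquiv K e).symm.surjective

theorem ker_joinQuot (I : Ideal (MvPolynomial σ K)) (J : Ideal (MvPolynomial τ K)) :
    RingHom.ker (joinQuot e I J) = join e I J := by
  have h : RingHom.ker (joinQuot e I J) = (RingHom.ker (Algebra.TensorProduct.map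
      (Ideal.Quotient.mkₐ K I) (Ideal.Quotient.mkₐ K J))).map (tensorEquiv K e) := by
    ext f
    rw [Ideal.mem_map_iff_of_surjective _ (tensorEquiv K e).surjective]
    refine ⟨fun hf ↦ ⟨(tensorEquiv K e).symm f, hf, (tensorEquiv K e).apply_symm_apply f⟩, ?_⟩
    rintro ⟨x, hx, rfl⟩
    change Algebra.TensorProduct.map _ _ ((tensorEquiv K e).symm (tensorEquiv K e x)) = 0
    rwa [AlgEquiv.symm_apply_apply]
  have hI : RingHom.ker (Ideal.Quotient.mkₐ K I) = I := Ideal.mk_ker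
  have hJ : RingHom.ker (Ideal.Quotient.mkₐ K J) = J := Ideal.mk_ker
  rw [h, Algebra.TensorProduct.map_ker _ _ (Ideal.Quotient.mkₐ_surjective K I)
    (Ideal.Quotient.mkₐ_surjective K J), hI, hJ, Ideal.map_sup, join]
  have hl : (tensorEquiv K e).toAlgHom.comp Algebra.TensorProduct.includeLeft =
      inclLeft (K := K) e :=
    AlgHom.ext fun f ↦ by simpa using tensorEquiv_tmul e f 1
  have hr : (tensorEquiv K e).toAlgHom.comp Algebra.TensorProduct.includeRight =
      inclRight (K := K) e :=
    AlgHom.ext fun f ↦ by simpa using tensorEquiv_tmul e 1 f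
  rw [← hl, ← hr]
  exact congr_arg₂ _ (Ideal.map_mapₐ (g := (tensorEquiv K e).toAlgHom) _)
    (Ideal.map_mapₐ (g := (tensorEquiv K e).toAlgHom) _)

/-- Applying a linear functional to the second block of variables. -/
noncomputable def contractRight (l : MvPolynomial τ K →ₗ[K] K) :
    MvPolynomial ρ K →ₗ[K] MvPolynomial σ K :=
  (TensorProduct.rid K (MvPolynomial σ K)).toLinearMap ∘ₗ l.lTensor (MvPolynomial σ K) ∘ₗ
    (tensorEquiv K e).symm.toLinearMap

@[simp]
theorem contractRight_mul (l : MvPolynomial τ K →ₗ[K] K) (f : MvPolynomial σ K)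
    (g : MvPolynomial τ K) :
    contractRight e l (inclLeft e f * inclRight e g) = l g • f := by
  simp [contractRight, tensorEquiv_symm_mul]

theorem join_induction {p : MvPolynomial ρ K → Prop} (f : MvPolynomial ρ K)
    (mul : ∀ g h, p (inclLeft e g * inclRight e h)) (add : ∀ g h, p g → p h → p (g + h)) : p f := by
  obtain ⟨x, rfl⟩ := (tensorEquiv K e).surjective f
  induction x with
  | zero => simpa using mul 0 0
  | tmul g h => rw [tensorEquiv_tmul]; exact mul g h
  | add x y hx hy => rw [map_add]; exact add _ _ hx hy

/-- Functionals killing J are the functionals on S/J, and these separate the elements of (R/I) ⊗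
(S/J). -/
theorem mem_join_iff (I : Ideal (MvPolynomial σ K)) (J : Ideal (MvPolynomial τ K))
    (f : MvPolynomial ρ K) :
    f ∈ join e I J ↔
      ∀ l : MvPolynomial τ K →ₗ[K] K, (∀ g ∈ J, l g = 0) → contractRight e l f ∈ I := by
  have key (l : (MvPolynomial τ K ⧸ J) →ₗ[K] K) (f : MvPolynomial ρ K) :
      TensorProduct.rid K _ (l.lTensor (MvPolynomial σ K ⧸ I) (joinQuot e I J f)) =
        Ideal.Quotient.mkₐ K I
          (contractRight e (l ∘ₗ (Ideal.Quotient.mkₐ K J).toLinearMap) f) := by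
    induction f using join_induction e with
    | mul g h => simp [joinQuot, tensorEquiv_symm_mul, -map_mul]
    | add g h hg hh => simp only [map_add, hg, hh]
  rw [← ker_joinQuot, RingHom.mem_ker]
  constructor
  · intro hf l hl
    have := key ((J.restrictScalars K).liftQ l hl) f
    rw [hf, LinearMap.map_zero, LinearEquiv.map_zero, eq_comm] at this
    exact Ideal.Quotient.eq_zero_iff_mem.1 this
  · intro h
    refine eq_zero_of_forall_lTensor_eq_zero
      (fun l : Module.Dual K (MvPolynomial τ K ⧸ J) ↦ l)
      (fun n ↦ (Module.forall_dual_apply_eq_zero_iff K n).1) _ fun l ↦ ?_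
    refine (TensorProduct.rid K _).map_eq_zero_iff.1 ((key l f).trans ?_)
    refine Ideal.Quotient.eq_zero_iff_mem.2 (h _ fun g hg ↦ ?_)
    have : Ideal.Quotient.mkₐ K J g = 0 := Ideal.Quotient.eq_zero_iff_mem.2 hg
    rw [LinearMap.comp_apply, AlgHom.toLinearMap_apply, this, LinearMap.map_zero]

theorem exists_functional {J : Ideal (MvPolynomial τ K)} (hJ : J ≠ ⊤) :
    ∃ l : MvPolynomial τ K →ₗ[K] K, (∀ g ∈ J, l g = 0) ∧ l 1 = 1 := by
  obtain ⟨l, hl, hl1⟩ := LinearMap.exists_extend_of_notMem (p := J.restrictScalars K)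
    (0 : _ →ₗ[K] K) ((Ideal.ne_top_iff_one J).1 hJ) 1
  exact ⟨l, fun g hg ↦ LinearMap.congr_fun hl ⟨g, hg⟩, hl1⟩

/-- The first ideal is recovered from the join by contraction. -/
theorem inclLeft_mem_join_iff {J : Ideal (MvPolynomial τ K)} (hJ : J ≠ ⊤)
    (I : Ideal (MvPolynomial σ K)) (f : MvPolynomial σ K) :
    inclLeft e f ∈ join e I J ↔ f ∈ I := by
  constructor
  · obtain ⟨l, hl, hl1⟩ := exists_functional hJ
    intro h
    have := (mem_join_iff e I J _).1 h l hl
    rw [← mul_one (inclLeft e f), ← map_one (inclRight e), contractRight_mul, hl1, one_smul] at this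
    exact this
  · exact fun h ↦ Ideal.mem_sup_left (Ideal.mem_map_of_mem _ h)

theorem join_injective {J : Ideal (MvPolynomial τ K)} (hJ : J ≠ ⊤)
    {I I' : Ideal (MvPolynomial σ K)} (h : join e I J = join e I' J) : I = I' := by
  ext f
  rw [← inclLeft_mem_join_iff e hJ, h, inclLeft_mem_join_iff e hJ]

theorem join_ne_top {I : Ideal (MvPolynomial σ K)} {J : Ideal (MvPolynomial τ K)} (hI : I ≠ ⊤)
    (hJ : J ≠ ⊤) : join e I J ≠ ⊤ := by
  rw [Ideal.ne_top_iff_one] at hI ⊢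
  rwa [← map_one (inclLeft e), inclLeft_mem_join_iff e hJ]

/-- The functionals to be tested in `mem_join_iff` depend on J alone. -/
theorem join_inf (I I' : Ideal (MvPolynomial σ K)) (J : Ideal (MvPolynomial τ K)) :
    join e (I ⊓ I') J = join e I J ⊓ join e I' J := by
  ext f
  simp only [Submodule.mem_inf, mem_join_iff]
  grind

theorem join_sup (I I' : Ideal (MvPolynomial σ K)) (J : Ideal (MvPolynomial τ K)) :
    join e (I ⊔ I') J = join e I J ⊔ I'.map (inclLeft e) := by
  rw [join, join, Ideal.map_sup]
  ac_rfl

@[simp]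
theorem join_top_left (J : Ideal (MvPolynomial τ K)) : join e ⊤ J = ⊤ := by
  rw [join, Ideal.map_top, top_sup_eq]

theorem finiteRingKrullDim_mvPolynomial (n : Type*) [Finite n] :
    FiniteRingKrullDim (MvPolynomial n K) := by
  rw [finiteRingKrullDim_iff_ne_bot_and_top, MvPolynomial.ringKrullDim_of_isNoetherianRing,
    ringKrullDim_eq_zero_of_field, zero_add]
  exact ⟨by simp, ne_of_lt (WithBot.coe_lt_coe.2 (ENat.natCast_lt_top (Nat.card n)))⟩

/-- The tensor product of Noether normalizations of the two quotients is again a polynomial ring,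
and its map to the quotient by the join is finite, and injective by flatness over K. -/
theorem isUnmixed_join_iff [Finite σ] [Finite τ] {I : Ideal (MvPolynomial σ K)}
    {J : Ideal (MvPolynomial τ K)} (hI : I ≠ ⊤) (hJ : J ≠ ⊤) :
    IsUnmixed (join e I J) ↔ IsUnmixed I ∧ IsUnmixed J := by
  have : Finite ρ := .of_equiv _ e
  have := Ideal.Quotient.nontrivial_iff.2 hI
  have := Ideal.Quotient.nontrivial_iff.2 hJ
  obtain ⟨s, g, hg, hgf⟩ := exists_finite_inj_algHom_of_fg K (MvPolynomial σ K ⧸ I)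
  obtain ⟨t, h, hh, hhf⟩ := exists_finite_inj_algHom_of_fg K (MvPolynomial τ K ⧸ J)
  have e₀ : (MvPolynomial (Fin s) K ⊗[K] MvPolynomial (Fin t) K) ≃ₐ[K]
    MvPolynomial (Fin s ⊕ Fin t) K := tensorEquivSum K _ _ K
  have : IsDomain (MvPolynomial (Fin s) K ⊗[K] MvPolynomial (Fin t) K) :=
    e₀.toRingEquiv.isDomain_iff.2 inferInstance
  have := finiteRingKrullDim_mvPolynomial (K := K) (Fin s)
  have := finiteRingKrullDim_mvPolynomial (K := K) (Fin t)
  have : FiniteRingKrullDim (MvPolynomial (Fin s) K ⊗[K] MvPolynomial (Fin t) K) := by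
    have := finiteRingKrullDim_mvPolynomial (K := K) (Fin s ⊕ Fin t)
    rw [finiteRingKrullDim_iff_ne_bot_and_top] at this ⊢
    rwa [ringKrullDim_eq_of_ringEquiv e₀.toRingEquiv]
  let q : (MvPolynomial ρ K ⧸ join e I J) ≃ₐ[K] (MvPolynomial σ K ⧸ I) ⊗[K] (MvPolynomial τ K ⧸ J) :=
    (Ideal.quotientEquivAlgOfEq K (ker_joinQuot e I J).symm).trans
      (Ideal.quotientKerAlgEquivOfSurjective (joinQuot_surjective e I J))
  let G := Algebra.TensorProduct.map g h
  have hG : Function.Injective G :=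
    TensorProduct.map_injective_of_flat_flat g.toLinearMap h.toLinearMap hg hh
  have hGf : G.Finite := RingHom.Finite.tensorProductMap hgf hhf
  rw [isUnmixed_iff_of_isIntegral_of_injective I g.toRingHom hgf.to_isIntegral hg,
    isUnmixed_iff_of_isIntegral_of_injective J h.toRingHom hhf.to_isIntegral hh,
    isUnmixed_iff_of_isIntegral_of_injective (join e I J)
      (q.symm.toAlgHom.comp G).toRingHom
      (hGf.to_isIntegral.trans _ _ (RingHom.isIntegral_of_surjective _ q.symm.surjective))
      (q.symm.injective.comp hG)]
  refine Iff.trans ?_ (tensor_torsionFree_iff g h hgf hhf)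
  refine forall_congr' fun t ↦ ⟨fun H b hb ↦ ?_, fun H b hb ↦ ?_⟩
  · refine (H (q.symm b) ?_).imp_right fun h ↦ by simpa using h
    change q.symm (G t) * q.symm b = 0
    rw [← map_mul q.symm, hb, map_zero q.symm]
  · refine (H (q b) ?_).imp_right fun h ↦ by simpa using h
    have : q.symm (G t) * b = 0 := hb
    refine q.symm.injective ?_
    rwa [map_mul q.symm, q.symm_apply_apply, map_zero q.symm]

end Join

/-! ### Coefficients with respect to one variable, and compatible monomial orders. -/

section YCoeff

variable {σ : Type u} {K : Type v} [Field K]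

theorem coeff_yCoeff (y : σ) (i : ℕ) (f : MvPolynomial σ K) (a : σ →₀ ℕ) :
    coeff a (yCoeff y i f) = if a y = 0 then coeff (a + Finsupp.single y i) f else 0 := by
  classical
  rw [yCoeff, coeff_sum]
  simp only [coeff_monomial]
  split_ifs with ha
  · rw [Finset.sum_eq_single (a + Finsupp.single y i)]
    · rw [if_pos]
      ext x
      by_cases hx : x = y
      · simp [hx, ha]
      · simp [Finsupp.erase_ne hx]
    · intro b hb hne
      refine if_neg fun h ↦ hne ?_
      rw [Finset.mem_filter] at hb
      rw [← h, ← hb.2, Finsupp.erase_add_single]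
    · intro hb
      rw [Finset.mem_filter, not_and'] at hb
      rw [notMem_support_iff.1 (hb (by simp [ha])), ite_self]
  · refine Finset.sum_eq_zero fun b _ ↦ if_neg ?_
    rintro rfl
    simp at ha

variable (K) in
/-- `yCoeff` as a linear map. -/
noncomputable def yCoeffLinearMap (y : σ) (i : ℕ) : MvPolynomial σ K →ₗ[K] MvPolynomial σ K where
  toFun := yCoeff y i
  map_add' f g := by
    ext a
    simp only [coeff_yCoeff, coeff_add]
    split_ifs <;> simp
  map_smul' c f := by
    ext a
    simp [coeff_yCoeff]

@[simp]
theorem yCoeffLinearMap_apply (y : σ) (i : ℕ) (f : MvPolynomial σ K) :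
    yCoeffLinearMap K y i f = yCoeff y i f := rfl

@[simp]
theorem yCoeff_zero_right (y : σ) (i : ℕ) : yCoeff y i (0 : MvPolynomial σ K) = 0 :=
  (yCoeffLinearMap K y i).map_zero

theorem yCoeff_sub (y : σ) (i : ℕ) (f g : MvPolynomial σ K) :
    yCoeff y i (f - g) = yCoeff y i f - yCoeff y i g :=
  (yCoeffLinearMap K y i).map_sub f g

theorem yCoeff_monomial_mul (y : σ) (i : ℕ) (a : σ →₀ ℕ) (c : K) (g : MvPolynomial σ K) :
    yCoeff y (a y + i) (monomial a c * g) = monomial (a.erase y) c * yCoeff y i g := by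
  classical
  ext b
  rw [coeff_yCoeff, coeff_monomial_mul', coeff_monomial_mul', coeff_yCoeff]
  by_cases hb : b y = 0
  · have hle : a ≤ b + Finsupp.single y (a y + i) ↔ a.erase y ≤ b := by
      refine forall_congr' fun x ↦ ?_
      by_cases hx : x = y
      · simp [hx, hb]
      · simp [Finsupp.erase_ne hx, Ne.symm hx]
    rw [if_pos hb]
    simp only [hle]
    split_ifs with h1 h2
    · congr 2
      ext x
      by_cases hx : x = y
      · simp [hx, hb]
      · simp [Finsupp.erase_ne hx, Ne.symm hx]
    · simp [hb] at h2
    · rfl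
  · rw [if_neg hb, if_neg (c := (b - a.erase y) y = 0), mul_zero, ite_self]
    simpa using hb

theorem degreeOf_le_iff_yCoeff {y : σ} {d : ℕ} {f : MvPolynomial σ K} :
    f.degreeOf y ≤ d ↔ ∀ i, d < i → yCoeff y i f = 0 := by
  classical
  rw [degreeOf_le_iff]
  constructor
  · intro h i hi
    ext a
    rw [coeff_yCoeff, coeff_zero]
    split_ifs with ha
    · by_contra hne
      have := h _ (mem_support_iff.2 hne)
      simp [ha] at this
      omega
    · rfl
  · intro h a ha
    by_contra! hlt
    have := congrArg (coeff (a.erase y)) (h _ hlt)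
    rw [coeff_yCoeff, if_pos (by simp), Finsupp.erase_add_single, coeff_zero] at this
    exact mem_support_iff.1 ha this

theorem yCoeff_zero_of_degreeOf_eq_zero {y : σ} {f : MvPolynomial σ K} (hf : f.degreeOf y = 0) :
    yCoeff y 0 f = f := by
  classical
  ext a
  rw [coeff_yCoeff, Finsupp.single_zero, add_zero]
  split_ifs with ha
  · rfl
  · by_contra hne
    exact ha (Nat.le_zero.1 (degreeOf_le_iff.1 hf.le a (mem_support_iff.2 (Ne.symm hne))))

theorem yLeadCoeff_of_degreeOf_eq_zero {y : σ} {f : MvPolynomial σ K} (hf : f.degreeOf y = 0) :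
    yLeadCoeff y f = f := by
  rw [yLeadCoeff, hf, yCoeff_zero_of_degreeOf_eq_zero hf]

theorem coeff_initialYForm (y : σ) (f : MvPolynomial σ K) (a : σ →₀ ℕ) :
    coeff a (initialYForm y f) = if a y = f.degreeOf y then coeff a f else 0 := by
  classical
  rw [initialYForm, yLeadCoeff, X_pow_eq_monomial, coeff_mul_monomial', coeff_yCoeff]
  simp only [Finsupp.single_le_iff, mul_one, Finsupp.tsub_apply, Finsupp.single_eq_same]
  split_ifs with h1 h2 h3 h4 h5
  · rw [tsub_add_cancel_of_le (Finsupp.single_le_iff.2 h1)]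
  · omega
  · omega
  · rfl
  · omega
  · rfl

/-- The leading monomial of f occurs in in_y(f), all of whose monomials have the full y-degree. -/
theorem degree_apply_of_isYCompatible {m : MonomialOrder σ} {y : σ} (hm : IsYCompatible K m y)
    {f : MvPolynomial σ K} (hf : f ≠ 0) : m.degree f y = f.degreeOf y := by
  have hne : initialYForm y f ≠ 0 := by
    rw [Ne, ← m.leadingTerm_eq_zero_iff, ← hm f, m.leadingTerm_eq_zero_iff]
    exact hf
  have h := m.degree_mem_support hne
  rw [← m.degree_leadingTerm, ← hm f, m.degree_leadingTerm, mem_support_iff,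
    coeff_initialYForm] at h
  by_contra hne
  exact h (if_neg hne)

variable (K) in
theorem exists_isYCompatible [Finite σ] (y : σ) :
    ∃ m : MonomialOrder.{u, u} σ, IsYCompatible K m y := by
  classical
  obtain ⟨n, ⟨r⟩⟩ := Finite.exists_equiv_fin σ
  -- In the lexicographic order the least index is the most significant, so y receives key 0.
  let key (x : σ) : ℕ := if x = y then 0 else (r x : ℕ) + 1
  have hkey : Function.Injective key := by
    intro a b hab
    simp only [key] at hab
    split_ifs at hab with h1 h2
    · rw [h1, h2]
    · exact r.injective (Fin.ext (by omega))
  let _ : LinearOrder σ := LinearOrder.lift' key hkey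
  refine ⟨MonomialOrder.lex, fun f ↦ ?_⟩
  by_cases hf : f = 0
  · simp [hf, initialYForm, yLeadCoeff]
  have hlt (a b : σ →₀ ℕ) (h : a y < b y) :
      MonomialOrder.lex.toSyn a < MonomialOrder.lex.toSyn b := by
    refine ⟨y, fun x hx ↦ ?_, h⟩
    have : key x < key y := hx
    simp [key] at this
  set m : MonomialOrder σ := MonomialOrder.lex
  have hdeg : m.degree f y = f.degreeOf y := by
    refine le_antisymm (degreeOf_le_iff.1 le_rfl _ (m.degree_mem_support hf)) ?_
    refine degreeOf_le_iff.2 fun a ha ↦ ?_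
    by_contra! h
    exact (m.le_degree ha).not_gt (hlt _ _ h)
  have hcoeff : coeff (m.degree f) (initialYForm y f) = m.leadingCoeff f := by
    rw [coeff_initialYForm, if_pos hdeg]
    rfl
  have hd : m.degree (initialYForm y f) = m.degree f := by
    apply m.toSyn.injective
    apply le_antisymm
    · refine m.degree_le_iff.2 fun a ha ↦ m.le_degree ?_
      rw [mem_support_iff, coeff_initialYForm] at ha
      rw [mem_support_iff]
      split_ifs at ha
      · exact ha
      · exact absurd rfl ha
    · refine m.le_degree (mem_support_iff.2 ?_)
      rw [hcoeff]
      exact m.leadingCoeff_ne_zero_iff.2 hf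
  rw [MonomialOrder.leadingTerm, MonomialOrder.leadingTerm, hd]
  congr 1
  rw [← hcoeff, ← hd]
  rfl

end YCoeff

/-! ### Gröbner-free descriptions of C and N. -/

section Groebner

variable {σ : Type u} {K : Type v} [Field K]

theorem exists_isGroebnerBasis [Finite σ] (m : MonomialOrder σ) (I : Ideal (MvPolynomial σ K)) :
    ∃ G, IsGroebnerBasis m G I := by
  classical
  obtain ⟨s, hs, hspan⟩ := Submodule.fg_span_iff_fg_span_finset_subset _ |>.1
    (IsNoetherian.noetherian (initialIdeal m I))
  obtain ⟨G, hG, rfl⟩ := Finset.subset_set_image_iff.1 hs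
  exact ⟨G, fun g hg ↦ hG hg, by rw [Finset.coe_image] at hspan; exact hspan⟩

theorem IsGroebnerBasis.exists_degree_le {m : MonomialOrder σ} {G : Finset (MvPolynomial σ K)}
    {I : Ideal (MvPolynomial σ K)} (hG : IsGroebnerBasis m G I) {f : MvPolynomial σ K}
    (hf : f ∈ I) (hf0 : f ≠ 0) : ∃ g ∈ G, g ≠ 0 ∧ m.degree g ≤ m.degree f := by
  have h : m.leadingTerm f ∈ initialIdeal m I := Ideal.subset_span ⟨f, hf, rfl⟩
  rw [hG.2, m.span_leadingTerm_eq_span_monomial', ← Set.image_image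
    (fun s ↦ monomial s (1 : K)) m.degree, mem_ideal_span_monomial_image] at h
  obtain ⟨_, ⟨g, hg, rfl⟩, hle⟩ := h (m.degree f) (by
    rw [m.support_leadingTerm' hf0, Finset.mem_singleton])
  exact ⟨g, hg.1, hg.2, hle⟩

/-- Induction along the reduction of elements of `I` modulo a Gröbner basis. -/
theorem IsGroebnerBasis.induction {m : MonomialOrder σ} {G : Finset (MvPolynomial σ K)}
    {I : Ideal (MvPolynomial σ K)} (hG : IsGroebnerBasis m G I) {p : MvPolynomial σ K → Prop}
    (zero : p 0)
    (reduce : ∀ f g, f ≠ 0 → g ∈ G → g ≠ 0 → ∀ a c, m.degree f = a + m.degree g →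
      p (f - monomial a c * g) → p f)
    {f : MvPolynomial σ K} (hf : f ∈ I) : p f := by
  induction hd : m.toSyn (m.degree f) using WellFoundedLT.induction generalizing f with
  | ind d ih =>
    by_cases hf0 : f = 0
    · rwa [hf0]
    obtain ⟨g, hgG, hg0, hle⟩ := hG.exists_degree_le hf hf0
    have hlc : m.leadingCoeff g ≠ 0 := m.leadingCoeff_ne_zero_iff.2 hg0
    have hlcf : m.leadingCoeff f ≠ 0 := m.leadingCoeff_ne_zero_iff.2 hf0
    set a := m.degree f - m.degree g
    set c := m.leadingCoeff f / m.leadingCoeff g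
    have hc : c ≠ 0 := div_ne_zero hlcf hlc
    have hmon : monomial a c ≠ 0 := by rwa [Ne, monomial_eq_zero]
    have hdeg : m.degree (monomial a c * g) = m.degree f := by
      classical
      rw [m.degree_mul hmon hg0, m.degree_monomial, if_neg hc, tsub_add_cancel_of_le hle]
    have hlead : m.leadingCoeff (monomial a c * g) = m.leadingCoeff f := by
      rw [m.leadingCoeff_mul, m.leadingCoeff_monomial, div_mul_cancel₀ _ hlc]
    refine reduce f g hf0 hgG hg0 a c (tsub_add_cancel_of_le hle).symm ?_
    by_cases h0 : f - monomial a c * g = 0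
    · rwa [h0]
    refine ih _ ?_ (I.sub_mem hf (I.mul_mem_left _ (hG.1 g hgG))) rfl
    rw [← hd]
    refine lt_of_le_of_ne (m.degree_sub_le.trans (by rw [hdeg, max_self])) fun h ↦ ?_
    have hs := m.degree_mem_support h0
    rw [m.toSyn.injective h, mem_support_iff, coeff_sub] at hs
    refine hs (sub_eq_zero.2 ?_)
    change m.leadingCoeff f = _
    rw [← hlead, MonomialOrder.leadingCoeff, hdeg]

/-- The ideal of the leading coefficients with respect to `y` of all the elements of `I`. -/
noncomputable def leadIdeal (y : σ) (I : Ideal (MvPolynomial σ K)) : Ideal (MvPolynomial σ K) :=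
  Ideal.span (yLeadCoeff y '' I)

/-- The ideal generated by the elements of `I` not involving `y`. -/
noncomputable def freeIdeal (y : σ) (I : Ideal (MvPolynomial σ K)) : Ideal (MvPolynomial σ K) :=
  Ideal.span {f | f ∈ I ∧ f.degreeOf y = 0}

theorem freeIdeal_le (y : σ) (I : Ideal (MvPolynomial σ K)) : freeIdeal y I ≤ I :=
  Ideal.span_le.2 fun _ hf ↦ hf.1

theorem yCoeff_mem_leadIdeal {y : σ} {I : Ideal (MvPolynomial σ K)} {f : MvPolynomial σ K} {d : ℕ}
    (hf : f ∈ I) (hd : f.degreeOf y ≤ d) : yCoeff y d f ∈ leadIdeal y I := by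
  rcases hd.eq_or_lt with rfl | hd
  · exact Ideal.subset_span ⟨f, hf, rfl⟩
  · rw [degreeOf_le_iff_yCoeff.1 le_rfl d hd]
    exact zero_mem _

theorem yCoeff_mul_mem_initialYIdeal {y : σ} {I : Ideal (MvPolynomial σ K)} {f : MvPolynomial σ K}
    {d : ℕ} (hf : f ∈ I) (hd : f.degreeOf y ≤ d) : yCoeff y d f * X y ^ d ∈ initialYIdeal y I := by
  rcases hd.eq_or_lt with rfl | hd
  · exact Ideal.subset_span ⟨f, hf, rfl⟩
  · rw [degreeOf_le_iff_yCoeff.1 le_rfl d hd, zero_mul]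
    exact zero_mem _

theorem idealC_eq {m : MonomialOrder σ} {y : σ} (hm : IsYCompatible K m y)
    {G : Finset (MvPolynomial σ K)} {I : Ideal (MvPolynomial σ K)} (hG : IsGroebnerBasis m G I) :
    idealC y G = leadIdeal y I := by
  apply le_antisymm
  · refine Ideal.span_le.2 ?_
    rintro _ ⟨g, hg, rfl⟩
    exact Ideal.subset_span ⟨g, hG.1 g hg, rfl⟩
  · refine Ideal.span_le.2 ?_
    rintro _ ⟨f, hf, rfl⟩
    -- A reduction step may lower the y-degree while d stays fixed, hence the claim for all d at or
    -- above the degree; above it the coefficient is 0.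
    suffices ∀ d, f.degreeOf y ≤ d → yCoeff y d f ∈ idealC y G from this _ le_rfl
    refine hG.induction (p := fun f ↦ ∀ d, f.degreeOf y ≤ d → yCoeff y d f ∈ idealC y G) ?_ ?_ hf
    · simp
    · intro f g hf hgG hg a c hdeg ih d hd
      rcases hd.eq_or_lt with rfl | hd
      · have hy : f.degreeOf y = a y + g.degreeOf y := by
          rw [← degree_apply_of_isYCompatible hm hf, ← degree_apply_of_isYCompatible hm hg, hdeg,
            Finsupp.add_apply]
        have hle : (f - monomial a c * g).degreeOf y ≤ f.degreeOf y := by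
          refine (degreeOf_sub_le _ _ _).trans (max_le le_rfl ((degreeOf_mul_le _ _ _).trans ?_))
          rw [hy]
          classical
          exact add_le_add_left (degreeOf_le_iff.2 fun b hb ↦ by
            rw [Finset.mem_singleton.1 (support_monomial_subset hb)]) _
        have h := ih _ hle
        rw [yCoeff_sub] at h
        nth_rw 2 [hy] at h
        rw [yCoeff_monomial_mul] at h
        rw [← sub_add_cancel (yCoeff y (f.degreeOf y) f)]
        exact add_mem h (Ideal.mul_mem_left _ _ (Ideal.subset_span ⟨g, hgG, rfl⟩))
      · rw [degreeOf_le_iff_yCoeff.1 le_rfl d hd]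
        exact zero_mem _

theorem idealN_eq {m : MonomialOrder σ} {y : σ} (hm : IsYCompatible K m y)
    {G : Finset (MvPolynomial σ K)} {I : Ideal (MvPolynomial σ K)} (hG : IsGroebnerBasis m G I) :
    idealN y G = freeIdeal y I := by
  apply le_antisymm
  · refine Ideal.span_le.2 ?_
    rintro _ ⟨g, hg, hd, rfl⟩
    rw [yLeadCoeff_of_degreeOf_eq_zero hd]
    exact Ideal.subset_span ⟨hG.1 g hg, hd⟩
  · refine Ideal.span_le.2 ?_
    rintro f ⟨hf, hd⟩
    refine hG.induction (p := fun f ↦ f.degreeOf y = 0 → f ∈ idealN y G) ?_ ?_ hf hd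
    · exact fun _ ↦ zero_mem _
    · intro f g hf hgG hg a c hdeg ih hd
      have hy : f.degreeOf y = a y + g.degreeOf y := by
        rw [← degree_apply_of_isYCompatible hm hf, ← degree_apply_of_isYCompatible hm hg, hdeg,
          Finsupp.add_apply]
      -- By compatibility y-degrees add up along leading monomials, so an element free of y is
      -- reduced only by basis elements free of y.
      have hg0 : g.degreeOf y = 0 := by omega
      have hgN : g ∈ idealN y G :=
        Ideal.subset_span ⟨g, hgG, hg0, (yLeadCoeff_of_degreeOf_eq_zero hg0).symm⟩
      rw [← sub_add_cancel f (monomial a c * g)]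
      refine add_mem (ih (Nat.le_zero.1 ?_)) (Ideal.mul_mem_left _ _ hgN)
      refine (degreeOf_sub_le _ _ _).trans (max_le hd.le ((degreeOf_mul_le _ _ _).trans ?_))
      rw [hg0, add_zero]
      classical
      exact degreeOf_le_iff.2 fun b hb ↦ by
        rw [Finset.mem_singleton.1 (support_monomial_subset hb)]
        omega

/-- Geometric vertex decomposability without monomial orders and Gröbner bases. -/
theorem isGeomVertexDecomposable_iff [Finite σ] (I : Ideal (MvPolynomial σ K)) :
    IsGeomVertexDecomposable I ↔ IsUnmixed I ∧
      ((I = ⊤ ∨ ∃ s : Set σ, I = Ideal.span (X '' s)) ∨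
        ∃ y, initialYIdeal y I = leadIdeal y I ⊓ (freeIdeal y I ⊔ Ideal.span {X y}) ∧
          IsGeomVertexDecomposable (contract y (leadIdeal y I)) ∧
          IsGeomVertexDecomposable (contract y (freeIdeal y I))) := by
  constructor
  · intro h
    cases h with
    | trivial _ unmixed h => exact ⟨unmixed, .inl h⟩
    | step _ unmixed y m compatible G groebner decomposition hC hN =>
      rw [idealC_eq compatible groebner] at decomposition hC
      rw [idealN_eq compatible groebner] at decomposition hN
      exact ⟨unmixed, .inr ⟨y, decomposition, hC, hN⟩⟩
  · rintro ⟨unmixed, h | ⟨y, decomposition, hC, hN⟩⟩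
    · exact .trivial _ unmixed h
    · obtain ⟨m, hm⟩ := exists_isYCompatible K y
      obtain ⟨G, hG⟩ := exists_isGroebnerBasis m I
      rw [← idealC_eq hm hG] at decomposition hC
      rw [← idealN_eq hm hG] at decomposition hN
      exact .step _ unmixed y m hm G hG decomposition hC hN

end Groebner

/-! ### Coefficient extraction under injective renaming. -/

section Rename

variable {σ ρ : Type u} {K : Type v} [Field K]

theorem yCoeff_monomial (y : σ) (i : ℕ) (a : σ →₀ ℕ) (c : K) [Decidable (a y = i)] :
    yCoeff y i (monomial a c) = if a y = i then monomial (a.erase y) c else 0 := by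
  classical
  by_cases hc : c = 0
  · simp [hc]
  rw [yCoeff, support_monomial, if_neg hc, Finset.filter_singleton]
  split_ifs <;> simp

theorem erase_mapDomain {k : σ → ρ} (hk : Function.Injective k) (y : σ) (a : σ →₀ ℕ) :
    (a.mapDomain k).erase (k y) = (a.erase y).mapDomain k := by
  ext x
  by_cases hx : x ∈ Set.range k
  · obtain ⟨x, rfl⟩ := hx
    rw [Finsupp.mapDomain_apply hk]
    by_cases hxy : x = y
    · simp [hxy]
    · rw [Finsupp.erase_ne (hk.ne hxy), Finsupp.erase_ne hxy, Finsupp.mapDomain_apply hk]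
  · rw [Finsupp.mapDomain_of_notMem_range _ _ hx, Finsupp.erase_ne (by rintro rfl; exact hx ⟨y, rfl⟩),
      Finsupp.mapDomain_of_notMem_range _ _ hx]

theorem yCoeff_rename {k : σ → ρ} (hk : Function.Injective k) (y : σ) (i : ℕ)
    (f : MvPolynomial σ K) : yCoeff (k y) i (rename k f) = rename k (yCoeff y i f) := by
  classical
  induction f using MvPolynomial.induction_on' with
  | monomial a c =>
    rw [rename_monomial, yCoeff_monomial, yCoeff_monomial, Finsupp.mapDomain_apply hk,
      erase_mapDomain hk, apply_ite (rename (R := K) k), rename_monomial, map_zero]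
  | add f g hf hg =>
    have h1 := (yCoeffLinearMap K (k y) i).map_add (rename k f) (rename k g)
    have h2 := (yCoeffLinearMap K y i).map_add f g
    simp only [yCoeffLinearMap_apply] at h1 h2
    rw [map_add, h1, h2, map_add, hf, hg]

end Rename

/-! ### Initial forms and decompositions of joins, and the induction. -/

section Join

variable {K : Type v} [Field K] {σ τ ρ : Type u} (e : σ ⊕ τ ≃ ρ)

theorem comp_inl_injective : Function.Injective (e ∘ Sum.inl) :=
  e.injective.comp Sum.inl_injective

theorem yCoeff_inclLeft_mul_inclRight (y : σ) (i : ℕ) (f : MvPolynomial σ K)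
    (g : MvPolynomial τ K) :
    yCoeff (e (.inl y)) i (inclLeft e f * inclRight e g) =
      inclLeft e (yCoeff y i f) * inclRight e g := by
  induction g using MvPolynomial.induction_on' with
  | monomial b c =>
    have hb : (b.mapDomain (e ∘ Sum.inr)) (e (.inl y)) = 0 :=
      Finsupp.mapDomain_of_notMem_range _ _ (by simp)
    have := yCoeff_monomial_mul (e (.inl y)) i (b.mapDomain (e ∘ Sum.inr)) c (inclLeft e f)
    rw [hb, zero_add, Finsupp.erase_of_notMem_support (by simpa using hb)] at this
    rw [rename_monomial, mul_comm, this, mul_comm]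
    congr 1
    exact yCoeff_rename (comp_inl_injective e) y i f
  | add g h hg hh =>
    have (y : ρ) := (yCoeffLinearMap K y i).map_add
    simp only [yCoeffLinearMap_apply] at this
    rw [map_add, mul_add, mul_add, this, hg, hh]

theorem contractRight_yCoeff (l : MvPolynomial τ K →ₗ[K] K) (y : σ) (i : ℕ)
    (f : MvPolynomial ρ K) :
    contractRight e l (yCoeff (e (.inl y)) i f) = yCoeff y i (contractRight e l f) := by
  simp only [← yCoeffLinearMap_apply]
  induction f using join_induction e with
  | mul g h =>
    rw [contractRight_mul, map_smul, yCoeffLinearMap_apply, yCoeff_inclLeft_mul_inclRight,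
      contractRight_mul, yCoeffLinearMap_apply]
  | add g h hg hh => simp only [map_add, hg, hh]

theorem contractRight_inclLeft_mul (l : MvPolynomial τ K →ₗ[K] K) (p : MvPolynomial σ K)
    (f : MvPolynomial ρ K) :
    contractRight e l (inclLeft e p * f) = p * contractRight e l f := by
  induction f using join_induction e with
  | mul g h => rw [← mul_assoc, ← map_mul, contractRight_mul, contractRight_mul, mul_smul_comm]
  | add g h hg hh => simp only [map_add, mul_add, hg, hh]

/-- The degree may drop strictly, which is why `yCoeff_mem_leadIdeal` and
`yCoeff_mul_mem_initialYIdeal` allow any d at or above the degree. -/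
theorem degreeOf_contractRight_le (l : MvPolynomial τ K →ₗ[K] K) (y : σ) (f : MvPolynomial ρ K) :
    (contractRight e l f).degreeOf y ≤ f.degreeOf (e (.inl y)) :=
  degreeOf_le_iff_yCoeff.2 fun i hi ↦ by
    rw [← contractRight_yCoeff, degreeOf_le_iff_yCoeff.1 le_rfl i hi, map_zero]

theorem degreeOf_inclLeft (y : σ) (f : MvPolynomial σ K) :
    (inclLeft e f).degreeOf (e (.inl y)) = f.degreeOf y :=
  degreeOf_rename_of_injective (comp_inl_injective e) y

theorem degreeOf_inclRight (y : σ) (g : MvPolynomial τ K) :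
    (inclRight e g).degreeOf (e (.inl y)) = 0 := by
  refine Nat.le_zero.1 (degreeOf_le_iff_yCoeff.2 fun i hi ↦ ?_)
  rw [← one_mul (inclRight e g), ← map_one (inclLeft e), yCoeff_inclLeft_mul_inclRight,
    degreeOf_le_iff_yCoeff.1 (degreeOf_one y).le i hi, map_zero, zero_mul]

theorem yLeadCoeff_inclLeft (y : σ) (f : MvPolynomial σ K) :
    yLeadCoeff (e (.inl y)) (inclLeft e f) = inclLeft e (yLeadCoeff y f) := by
  rw [yLeadCoeff, yLeadCoeff, degreeOf_inclLeft]
  exact yCoeff_rename (comp_inl_injective e) y _ f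

variable (I : Ideal (MvPolynomial σ K)) (J : Ideal (MvPolynomial τ K)) (y : σ)

theorem map_inclLeft_le_join : I.map (inclLeft e) ≤ join e I J := le_sup_left

theorem map_inclRight_le_join : J.map (inclRight e) ≤ join e I J := le_sup_right

theorem leadIdeal_join :
    leadIdeal (e (.inl y)) (join e I J) = join e (leadIdeal y I) J := by
  apply le_antisymm
  · refine Ideal.span_le.2 ?_
    rintro _ ⟨f, hf, rfl⟩
    refine (mem_join_iff e _ _ _).2 fun l hl ↦ ?_
    rw [yLeadCoeff, contractRight_yCoeff]
    exact yCoeff_mem_leadIdeal ((mem_join_iff e _ _ _).1 hf l hl) (degreeOf_contractRight_le e l y f)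
  · refine sup_le ?_ (Ideal.map_le_iff_le_comap.2 fun g hg ↦ ?_)
    · rw [leadIdeal, Ideal.map_span, Ideal.span_le]
      rintro _ ⟨_, ⟨f, hf, rfl⟩, rfl⟩
      exact Ideal.subset_span
        ⟨inclLeft e f, map_inclLeft_le_join e I J (Ideal.mem_map_of_mem _ hf),
          yLeadCoeff_inclLeft e y f⟩
    · exact Ideal.subset_span
        ⟨inclRight e g, map_inclRight_le_join e I J (Ideal.mem_map_of_mem _ hg),
          yLeadCoeff_of_degreeOf_eq_zero (degreeOf_inclRight e y g)⟩

theorem freeIdeal_join :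
    freeIdeal (e (.inl y)) (join e I J) = join e (freeIdeal y I) J := by
  apply le_antisymm
  · refine Ideal.span_le.2 ?_
    rintro f ⟨hf, hd⟩
    refine (mem_join_iff e _ _ _).2 fun l hl ↦ Ideal.subset_span
      ⟨(mem_join_iff e _ _ _).1 hf l hl, Nat.le_zero.1 ?_⟩
    rw [← hd]
    exact degreeOf_contractRight_le e l y f
  · refine sup_le ?_ (Ideal.map_le_iff_le_comap.2 fun g hg ↦ ?_)
    · rw [freeIdeal, Ideal.map_span, Ideal.span_le]
      rintro _ ⟨f, ⟨hf, hd⟩, rfl⟩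
      exact Ideal.subset_span ⟨map_inclLeft_le_join e I J (Ideal.mem_map_of_mem _ hf),
        (degreeOf_inclLeft e y f).trans hd⟩
    · exact Ideal.subset_span ⟨map_inclRight_le_join e I J (Ideal.mem_map_of_mem _ hg),
        degreeOf_inclRight e y g⟩

theorem initialYIdeal_join :
    initialYIdeal (e (.inl y)) (join e I J) = join e (initialYIdeal y I) J := by
  have hX : (X (e (.inl y)) : MvPolynomial ρ K) = inclLeft e (X y) := by simp
  apply le_antisymm
  · refine Ideal.span_le.2 ?_
    rintro _ ⟨f, hf, rfl⟩
    refine (mem_join_iff e _ _ _).2 fun l hl ↦ ?_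
    rw [initialYForm, yLeadCoeff, mul_comm, hX, ← map_pow, contractRight_inclLeft_mul,
      contractRight_yCoeff, mul_comm]
    exact yCoeff_mul_mem_initialYIdeal ((mem_join_iff e _ _ _).1 hf l hl)
      (degreeOf_contractRight_le e l y f)
  · refine sup_le ?_ (Ideal.map_le_iff_le_comap.2 fun g hg ↦ ?_)
    · rw [initialYIdeal, Ideal.map_span, Ideal.span_le]
      rintro _ ⟨_, ⟨f, hf, rfl⟩, rfl⟩
      refine Ideal.subset_span
        ⟨inclLeft e f, map_inclLeft_le_join e I J (Ideal.mem_map_of_mem _ hf), ?_⟩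
      rw [initialYForm, initialYForm, yLeadCoeff_inclLeft, degreeOf_inclLeft, map_mul, map_pow, hX]
    · refine Ideal.subset_span
        ⟨inclRight e g, map_inclRight_le_join e I J (Ideal.mem_map_of_mem _ hg), ?_⟩
      rw [initialYForm, yLeadCoeff_of_degreeOf_eq_zero (degreeOf_inclRight e y g),
        degreeOf_inclRight, pow_zero, mul_one]

theorem join_sup_span_X :
    join e I J ⊔ Ideal.span {X (e (.inl y))} = join e (I ⊔ Ideal.span {X y}) J := by
  rw [join_sup, Ideal.map_span, Set.image_singleton, rename_X]
  rfl

/-- Removing a variable of the first block. -/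
noncomputable def removeLeft : {x : σ // x ≠ y} ⊕ τ ≃ {z : ρ // z ≠ e (.inl y)} :=
  Equiv.ofBijective
    (Sum.elim (fun x ↦ ⟨e (.inl x), by simpa using x.2⟩) fun t ↦ ⟨e (.inr t), by simp⟩) <| by
    constructor
    · rintro (⟨a, _⟩ | a) (⟨b, _⟩ | b) h <;> simp at h <;> simp [h]
    · rintro ⟨z, hz⟩
      obtain ⟨x | t, rfl⟩ := e.surjective z
      · exact ⟨.inl ⟨x, by simpa using hz⟩, rfl⟩
      · exact ⟨.inr t, rfl⟩

theorem contract_join :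
    contract (e (.inl y)) (join e I J) = join (removeLeft e y) (contract y I) J := by
  have key (l : MvPolynomial τ K →ₗ[K] K) (f : MvPolynomial {z : ρ // z ≠ e (.inl y)} K) :
      contractRight e l (rename Subtype.val f) =
        rename Subtype.val (contractRight (removeLeft e y) l f) := by
    induction f using join_induction (removeLeft e y) with
    | mul g h =>
      have hg : rename Subtype.val (inclLeft (removeLeft e y) g) =
          inclLeft e (rename Subtype.val g) := by
        rw [rename_rename, rename_rename]
        rfl
      have hh : rename Subtype.val (inclRight (removeLeft e y) h) = inclRight e h := by
        rw [rename_rename]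
        rfl
      rw [contractRight_mul, map_mul, hg, hh, contractRight_mul, map_smul]
    | add g h hg hh => simp only [map_add, hg, hh]
  ext f
  rw [contract, Ideal.mem_comap, mem_join_iff, mem_join_iff]
  refine forall₂_congr fun l _ ↦ ?_
  rw [contract, Ideal.mem_comap, ← key]

theorem join_span_X (s : Set σ) (t : Set τ) :
    join e (Ideal.span (X '' s) : Ideal (MvPolynomial σ K)) (Ideal.span (X '' t)) =
      Ideal.span (X '' (e '' (Sum.inl '' s ∪ Sum.inr '' t))) := by
  simp only [join, Ideal.map_span, ← Ideal.span_union, Set.image_union, Set.image_image, rename_X,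
    Function.comp_apply]

variable {I J}

theorem exists_eq_span_X_of_join (hJ : J ≠ ⊤) (h : ∃ s : Set ρ, join e I J = Ideal.span (X '' s)) :
    ∃ s : Set σ, I = Ideal.span (X '' s) := by
  classical
  obtain ⟨s, hs⟩ := h
  -- Membership in an ideal generated by variables is read off the monomials, and those of f involve
  -- no variable of the second block.
  refine ⟨e ∘ Sum.inl ⁻¹' s, ?_⟩
  ext f
  rw [← inclLeft_mem_join_iff e hJ, hs, mem_ideal_span_X_image, mem_ideal_span_X_image,
    support_rename_of_injective (comp_inl_injective e), Finset.forall_mem_image]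
  refine forall₂_congr fun a _ ↦ ⟨?_, ?_⟩
  · rintro ⟨z, hz, hza⟩
    by_cases hr : z ∈ Set.range (e ∘ Sum.inl)
    · obtain ⟨x, rfl⟩ := hr
      exact ⟨x, hz, by rwa [Finsupp.mapDomain_apply (comp_inl_injective e)] at hza⟩
    · exact absurd (Finsupp.mapDomain_of_notMem_range _ _ hr) hza
  · rintro ⟨x, hx, hxa⟩
    exact ⟨_, hx, by rwa [Finsupp.mapDomain_apply (comp_inl_injective e)]⟩

theorem isUnmixed_top {R : Type*} [CommRing R] : IsUnmixed (⊤ : Ideal R) := fun _ hP ↦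
  have : Subsingleton (R ⧸ (⊤ : Ideal R)) := Ideal.Quotient.subsingleton_iff.2 rfl
  absurd hP not_isAssociatedPrime_of_subsingleton

theorem isGeomVertexDecomposable_top : IsGeomVertexDecomposable (⊤ : Ideal (MvPolynomial σ K)) :=
  .trivial _ isUnmixed_top (.inl rfl)

theorem contract_ne_top {I : Ideal (MvPolynomial σ K)} (hI : I ≠ ⊤) : contract y I ≠ ⊤ :=
  Ideal.comap_ne_top _ hI

/-- The second clause of geometric vertex decomposability for a variable of the first block. -/
theorem decomposition_join_iff (hJ : J ≠ ⊤) :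
    (initialYIdeal (e (.inl y)) (join e I J) = leadIdeal (e (.inl y)) (join e I J) ⊓
          (freeIdeal (e (.inl y)) (join e I J) ⊔ Ideal.span {X (e (.inl y))}) ∧
        IsGeomVertexDecomposable (contract (e (.inl y)) (leadIdeal (e (.inl y)) (join e I J))) ∧
        IsGeomVertexDecomposable (contract (e (.inl y)) (freeIdeal (e (.inl y)) (join e I J)))) ↔
      initialYIdeal y I = leadIdeal y I ⊓ (freeIdeal y I ⊔ Ideal.span {X y}) ∧
        IsGeomVertexDecomposable (join (removeLeft e y) (contract y (leadIdeal y I)) J) ∧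
        IsGeomVertexDecomposable (join (removeLeft e y) (contract y (freeIdeal y I)) J) := by
  rw [leadIdeal_join, freeIdeal_join, initialYIdeal_join, join_sup_span_X, ← join_inf,
    contract_join, contract_join]
  exact and_congr_left' ⟨join_injective e hJ, fun h ↦ by rw [h]⟩

/-- Induction on the total number of variables. The auxiliary statements are quantified over the
blocks so as to apply to `e` and to its swap. -/
theorem isGeomVertexDecomposable_join_iff (n : ℕ) {σ τ ρ : Type u} [Finite σ] [Finite τ]
    (e : σ ⊕ τ ≃ ρ) (hn : Nat.card ρ = n) {I : Ideal (MvPolynomial σ K)}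
    {J : Ideal (MvPolynomial τ K)} (hI : I ≠ ⊤) (hJ : J ≠ ⊤) :
    IsGeomVertexDecomposable (join e I J) ↔
      IsGeomVertexDecomposable I ∧ IsGeomVertexDecomposable J := by
  induction n using Nat.strong_induction_on generalizing σ τ ρ with
  | _ n ih =>
  have ih_mp {σ τ ρ : Type u} [Finite σ] [Finite τ] (e : σ ⊕ τ ≃ ρ) (hn : Nat.card ρ = n)
      {I : Ideal (MvPolynomial σ K)} {J : Ideal (MvPolynomial τ K)} (hJ : J ≠ ⊤) (y : σ)
      (h : IsGeomVertexDecomposable (join (removeLeft e y) (contract y I) J)) :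
      IsGeomVertexDecomposable (contract y I) ∧
        (I ≠ ⊤ → IsGeomVertexDecomposable J) := by
    have : Finite ρ := .of_equiv _ e
    -- The induction hypothesis needs proper ideals. When the contraction is the unit ideal so is
    -- the join, and nothing can be learned about J.
    by_cases hI : contract y I = ⊤
    · exact ⟨hI ▸ isGeomVertexDecomposable_top, fun hI' ↦ absurd hI (contract_ne_top y hI')⟩
    · have hlt : Nat.card {z // z ≠ e (.inl y)} < n :=
        hn ▸ Finite.card_subtype_lt (x := e (.inl y)) (by simp)
      exact ((ih _ hlt (removeLeft e y) rfl hI hJ).1 h).imp_right fun h _ ↦ h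
  have ih_mpr {σ τ ρ : Type u} [Finite σ] [Finite τ] (e : σ ⊕ τ ≃ ρ) (hn : Nat.card ρ = n)
      {I : Ideal (MvPolynomial σ K)} {J : Ideal (MvPolynomial τ K)} (hJ : J ≠ ⊤) (y : σ)
      (h : IsGeomVertexDecomposable (contract y I)) (h' : IsGeomVertexDecomposable J) :
      IsGeomVertexDecomposable (join (removeLeft e y) (contract y I) J) := by
    have : Finite ρ := .of_equiv _ e
    by_cases hI : contract y I = ⊤
    · rw [hI, join_top_left]
      exact isGeomVertexDecomposable_top
    · have hlt : Nat.card {z // z ≠ e (.inl y)} < n :=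
        hn ▸ Finite.card_subtype_lt (x := e (.inl y)) (by simp)
      exact (ih _ hlt (removeLeft e y) rfl hI hJ).2 ⟨h, h'⟩
  have step_mp {σ τ ρ : Type u} [Finite σ] [Finite τ] (e : σ ⊕ τ ≃ ρ) (hn : Nat.card ρ = n)
      {I : Ideal (MvPolynomial σ K)} {J : Ideal (MvPolynomial τ K)} (hI : I ≠ ⊤) (hJ : J ≠ ⊤)
      (y : σ) (hu : IsUnmixed I)
      (h : initialYIdeal (e (.inl y)) (join e I J) = leadIdeal (e (.inl y)) (join e I J) ⊓
          (freeIdeal (e (.inl y)) (join e I J) ⊔ Ideal.span {X (e (.inl y))}) ∧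
        IsGeomVertexDecomposable (contract (e (.inl y)) (leadIdeal (e (.inl y)) (join e I J))) ∧
        IsGeomVertexDecomposable (contract (e (.inl y)) (freeIdeal (e (.inl y)) (join e I J)))) :
      IsGeomVertexDecomposable I ∧ IsGeomVertexDecomposable J := by
    obtain ⟨hd, hC, hN⟩ := (decomposition_join_iff e y hJ).1 h
    have hN := ih_mp e hn hJ y hN
    exact ⟨(isGeomVertexDecomposable_iff I).2
      ⟨hu, .inr ⟨y, hd, (ih_mp e hn hJ y hC).1, hN.1⟩⟩,
      -- J is recovered from the N branch: N is contained in I and so is proper, whereas C may be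
      -- the whole ring.
      hN.2 (ne_top_of_le_ne_top hI (freeIdeal_le y I))⟩
  have step_mpr {σ τ ρ : Type u} [Finite σ] [Finite τ] (e : σ ⊕ τ ≃ ρ) (hn : Nat.card ρ = n)
      {I : Ideal (MvPolynomial σ K)} {J : Ideal (MvPolynomial τ K)} (hJ : J ≠ ⊤)
      (y : σ) (hu : IsUnmixed (join e I J)) (hJd : IsGeomVertexDecomposable J)
      (h : initialYIdeal y I = leadIdeal y I ⊓ (freeIdeal y I ⊔ Ideal.span {X y}) ∧
        IsGeomVertexDecomposable (contract y (leadIdeal y I)) ∧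
        IsGeomVertexDecomposable (contract y (freeIdeal y I))) :
      IsGeomVertexDecomposable (join e I J) := by
    have : Finite ρ := .of_equiv _ e
    exact (isGeomVertexDecomposable_iff _).2 ⟨hu, .inr ⟨e (.inl y), (decomposition_join_iff e y hJ).2
      ⟨h.1, ih_mpr e hn hJ y h.2.1 hJd, ih_mpr e hn hJ y h.2.2 hJd⟩⟩⟩
  have : Finite ρ := .of_equiv _ e
  have hIJ := isUnmixed_join_iff e hI hJ
  constructor
  · intro h
    obtain ⟨hu, (htop | hX) | ⟨z, hz⟩⟩ := (isGeomVertexDecomposable_iff _).1 h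
    · exact absurd htop (join_ne_top e hI hJ)
    · obtain ⟨hIu, hJu⟩ := hIJ.1 hu
      refine ⟨.trivial _ hIu (.inr (exists_eq_span_X_of_join e hJ hX)),
        .trivial _ hJu (.inr ?_)⟩
      rw [← join_swap] at hX
      exact exists_eq_span_X_of_join _ hI hX
    · obtain ⟨hIu, hJu⟩ := hIJ.1 hu
      obtain ⟨y | y, rfl⟩ := e.surjective z
      · exact step_mp e hn hI hJ y hIu hz
      · rw [← join_swap] at hz
        exact (step_mp ((Equiv.sumComm τ σ).trans e) hn hJ hI y hJu hz).symm
  · rintro ⟨hId, hJd⟩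
    -- A variable decomposing I or J decomposes the join as well; failing both, the two proper
    -- ideals are generated by variables, and so is their join.
    obtain ⟨hIu, hI' | ⟨y, hy⟩⟩ := (isGeomVertexDecomposable_iff I).1 hId
    · obtain ⟨hJu, hJ' | ⟨y, hy⟩⟩ := (isGeomVertexDecomposable_iff J).1 hJd
      · obtain ⟨s, rfl⟩ := hI'.resolve_left hI
        obtain ⟨t, rfl⟩ := hJ'.resolve_left hJ
        exact .trivial _ (hIJ.2 ⟨hIu, hJu⟩) (.inr ⟨_, join_span_X e s t⟩)
      · have hu := hIJ.2 ⟨hIu, hJu⟩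
        rw [← join_swap] at hu ⊢
        exact step_mpr _ hn hI y hu hId hy
    · exact step_mpr e hn hJ y
        (hIJ.2 ⟨hIu, ((isGeomVertexDecomposable_iff J).1 hJd).1⟩) hJd hy

end Join

end GVD

theorem theorem2 {K : Type v} [Field K] [IsAlgClosed K] [CharZero K]
    {σ τ : Type u} [Finite σ] [Finite τ]
    (I : Ideal (MvPolynomial σ K)) (J : Ideal (MvPolynomial τ K))
    (hI : I ≠ ⊤) (hJ : J ≠ ⊤) :
    (GVD.IsGeomVertexDecomposable I ∧ GVD.IsGeomVertexDecomposable J) ↔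
      GVD.IsGeomVertexDecomposable
        (I.map (MvPolynomial.rename (R := K) (Sum.inl : σ → σ ⊕ τ)) ⊔
          J.map (MvPolynomial.rename (R := K) (Sum.inr : τ → σ ⊕ τ))) :=
  (GVD.isGeomVertexDecomposable_join_iff _ (Equiv.refl (σ ⊕ τ)) rfl hI hJ).symm
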